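/- Let $\beta>1$ be a real number and let $T_\beta(x)=\beta x-\lfloor \beta x\rfloor$. For $x\in[0,1)$ and $n\ge 1$ let $\varepsilon_n(x)=\lfloor \beta\, T_\beta^{n-1}x\rfloor$ be the digits of the $\beta$-expansion of $x$, and let $\omega_n(x)=\sum_{k=1}^{n}\varepsilon_k(x)\beta^{-k}$ be its convergents. Let $\phi$ be a positive real-valued function on $\mathbb{N}=\{1,2,\dots\}$, put $\eta=\liminf_{n\to\infty}\phi(n)/n\in[0,\infty]$ and $$B_\phi=\Big\{x\in[0,1):\ \liminf_{n\to\infty}\frac{1}{\phi(n)}\log_\beta\big(x-\omega_n(x)\big)=-1\Big\},$$ where the lower limit is taken in $[-\infty,\infty]$ and $\log_\beta 0=-\infty$. Then: (i) if $0\le\eta<1$, then $B_\phi=\emptyset$; (ii) if $\phi$ is nondecreasing and $\eta\ge 1$, then the Hausdorff dimension of $B_\phi$ is $\dim_{\mathrm H}B_\phi=1/\eta$, where $1/\infty:=0$. -/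

import Mathlib

open Filter

noncomputable section

namespace BetaExpansion

/-- The β-transformation `T_β x = β x - ⌊β x⌋`. -/
def betaMap (β x : ℝ) : ℝ := β * x - (⌊β * x⌋ : ℝ)

/-- The digit `ε_{k+1}(x, β) = ⌊β T_β^k x⌋` (so the digits are indexed from `k = 0`). -/
def digit (β x : ℝ) (k : ℕ) : ℤ := ⌊β * (betaMap β)^[k] x⌋

/-- The convergent `ω_n(x, β) = ε_1 / β + ⋯ + ε_n / β ^ n`. -/
def convergent (β x : ℝ) (n : ℕ) : ℝ :=
  ∑ k ∈ Finset.range n, (digit β x k : ℝ) / β ^ (k + 1)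

/-- The logarithm to base `β` of a nonnegative real, with `log_β 0 = -∞`. -/
def elogb (β y : ℝ) : EReal := if 0 < y then ((Real.logb β y : ℝ) : EReal) else ⊥

/-- `η = liminf φ(n) / n`, a value in `[0, ∞]`. -/
def lowerRate (φ : ℕ → ℝ) : ENNReal :=
  liminf (fun n : ℕ => ENNReal.ofReal (φ n / (n : ℝ))) atTop

/-- The set of `x ∈ [0, 1)` with `liminf (1 / φ(n)) log_β (x - ω_n(x)) = -1`, the lower limit
being taken in the extended reals. -/
def approxSet (β : ℝ) (φ : ℕ → ℝ) : Set ℝ :=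
  {x | x ∈ Set.Ico (0 : ℝ) 1 ∧
    liminf (fun n : ℕ => ((1 / φ n : ℝ) : EReal) * elogb β (x - convergent β x n)) atTop = -1}

end BetaExpansion

end

noncomputable section
namespace BetaExpansion

/-! ### Remainders of the expansion -/

section Basic

variable {β x : ℝ}

/-! The error of the convergent of order `n` is `T^n x / β^n`, hence at most `β^(-n)`. If `φ n < c *
n` infinitely often with `c < 1`, the lower limit is at most `-1/c < -1`, so no point qualifies.

Upper bound on the dimension: a point of the set is infinitely often within about `β^(-φ n)` of a
convergent of order `n`, and there are at most `(n + 1) * β^n` of these (`ncard_convergents_le`).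
Covering by the corresponding intervals makes the `d`-dimensional measure vanish for `d > 1/η`.

Lower bound, for finite `η = h`: expansions are concatenated from full cylinders of a large order
`L`, of which there are at least `β^L / (L + 1)` (`le_ncard_fullStarts`), each followed by one extra
zero digit, so that different blocks are separated by gaps. Blocks are zero on very sparse runs `[p,
h * p)`, with `p` chosen where `φ n / n` is nearly `h`, and nonzero elsewhere. The runs force the
lower limit to be `-1` (`blockPoint_mem_approxSet`) and leave at least a proportion close to `1/h`
of the blocks free in every initial segment (`exists_zeroRuns`). Writing the base `M` digits of `t ∈
[0, 1)` into the free blocks gives an injection whose inverse is Hölder with exponent close to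
`1/h`, so the image has dimension at least that exponent. -/

theorem betaMap_mem_Ico (β x : ℝ) : betaMap β x ∈ Set.Ico (0 : ℝ) 1 :=
  ⟨Int.fract_nonneg _, Int.fract_lt_one _⟩

theorem iterate_betaMap_mem_Ico (hx : x ∈ Set.Ico (0 : ℝ) 1) (n : ℕ) :
    (betaMap β)^[n] x ∈ Set.Ico (0 : ℝ) 1 := by
  cases n with
  | zero => exact hx
  | succ n => rw [Function.iterate_succ_apply']; exact betaMap_mem_Ico _ _

theorem iterate_betaMap_one_mem_Icc (n : ℕ) : (betaMap β)^[n] 1 ∈ Set.Icc (0 : ℝ) 1 := by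
  cases n with
  | zero => simp
  | succ n =>
    rw [Function.iterate_succ_apply']
    exact Set.Ico_subset_Icc_self (betaMap_mem_Ico _ _)

theorem betaMap_eq_of_floor {y : ℝ} {d : ℤ} (h₁ : (d : ℝ) ≤ β * y) (h₂ : β * y < d + 1) :
    betaMap β y = β * y - d := by
  rw [betaMap, Int.floor_eq_iff.2 ⟨h₁, h₂⟩]

/-- The error of the `n`-th convergent is `T_β^n x / β ^ n`. -/
theorem sub_convergent (hβ : 0 < β) (x : ℝ) (n : ℕ) :
    x - convergent β x n = (betaMap β)^[n] x / β ^ n := by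
  induction n with
  | zero => simp [convergent]
  | succ n ih =>
    have h : convergent β x (n + 1) = convergent β x n + (digit β x n : ℝ) / β ^ (n + 1) := by
      rw [convergent, Finset.sum_range_succ, ← convergent]
    rw [h, ← sub_sub, ih, Function.iterate_succ_apply', betaMap, digit]
    field_simp
    ring

theorem iterate_betaMap_le (hβ : 0 < β) (hx : x ∈ Set.Ico (0 : ℝ) 1) (k : ℕ) :
    (betaMap β)^[k] x ≤ β ^ k * x := by
  induction k with
  | zero => simp
  | succ k ih =>
    have h0 := (iterate_betaMap_mem_Ico (β := β) hx k).1
    have h1 : (0 : ℝ) ≤ (⌊β * (betaMap β)^[k] x⌋ : ℝ) := by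
      exact_mod_cast Int.floor_nonneg.2 (by positivity)
    rw [Function.iterate_succ_apply', betaMap, pow_succ]
    nlinarith

/-- Points of `[0, 1)` whose first `n` digits agree are at distance at most `β ^ (-n)`. -/
theorem abs_sub_le_of_digit_eq (hβ : 0 < β) {y : ℝ} (hx : x ∈ Set.Ico (0 : ℝ) 1)
    (hy : y ∈ Set.Ico (0 : ℝ) 1) {n : ℕ} (h : ∀ k < n, digit β x k = digit β y k) :
    |x - y| ≤ (β ^ n)⁻¹ := by
  have hc : convergent β x n = convergent β y n :=
    Finset.sum_congr rfl fun k hk => by rw [h k (Finset.mem_range.1 hk)]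
  have h1 := sub_convergent hβ x n
  have h2 := sub_convergent hβ y n
  have h3 := iterate_betaMap_mem_Ico (β := β) hx n
  have h4 := iterate_betaMap_mem_Ico (β := β) hy n
  have hp : 0 < (β ^ n)⁻¹ := by positivity
  have h5 : x - y = ((betaMap β)^[n] x - (betaMap β)^[n] y) * (β ^ n)⁻¹ := by
    rw [sub_mul, ← div_eq_mul_inv, ← div_eq_mul_inv, ← h1, ← h2, hc]; ring
  rw [h5, abs_mul, abs_of_pos hp]
  have : |(betaMap β)^[n] x - (betaMap β)^[n] y| ≤ 1 := by
    rw [abs_le]; constructor <;> linarith [h3.1, h3.2, h4.1, h4.2]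
  nlinarith

end Basic

/-- Left end points of the intervals of length `β ^ (-n)` that `T_β^n` maps affinely onto
`[0, 1)`, the full cylinders of order `n`. -/
def fullStarts (β : ℝ) (n : ℕ) : Set ℝ :=
  {a | 0 ≤ a ∧ a + (β ^ n)⁻¹ ≤ 1 ∧
    ∀ y, a ≤ y → y < a + (β ^ n)⁻¹ → (betaMap β)^[n] y = β ^ n * (y - a)}

/-! ### Counting full cylinders and convergents -/

section Full

variable {β : ℝ}

/-- Appending the digit 0 to a full cylinder keeps its left end and stays full. -/
theorem fullStarts_subset_succ (hβ : 1 < β) (n : ℕ) : fullStarts β n ⊆ fullStarts β (n + 1) := by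
  rintro a ⟨h0, h1, h2⟩
  have hb : 0 < β := by linarith
  have hp : 0 < (β ^ n)⁻¹ := by positivity
  have hlt : (β ^ (n + 1))⁻¹ ≤ (β ^ n)⁻¹ :=
    inv_anti₀ (by positivity) (pow_le_pow_right₀ hβ.le n.le_succ)
  refine ⟨h0, by linarith, fun y hy hy' => ?_⟩
  rw [Function.iterate_succ_apply', h2 y hy (by linarith)]
  have h3 : β ^ (n + 1) * (y - a) < 1 := by
    have : y - a < (β ^ (n + 1))⁻¹ := by linarith
    calc _ < β ^ (n + 1) * (β ^ (n + 1))⁻¹ := by gcongr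
      _ = 1 := mul_inv_cancel₀ (by positivity)
  have h4 : 0 ≤ β ^ (n + 1) * (y - a) := mul_nonneg (by positivity) (by linarith)
  have h5 : β * (β ^ n * (y - a)) = β ^ (n + 1) * (y - a) := by ring
  rw [betaMap_eq_of_floor (d := 0) (by rw [h5]; simpa using h4) (by rw [h5]; simpa using h3), h5]
  simp

theorem fullStarts_mono (hβ : 1 < β) : Monotone (fullStarts β) :=
  monotone_nat_of_le_succ (fullStarts_subset_succ hβ)

theorem zero_mem_fullStarts (hβ : 1 < β) (n : ℕ) : (0 : ℝ) ∈ fullStarts β n :=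
  fullStarts_mono hβ n.zero_le (by simp [fullStarts])

/-- `T^n` vanishes at `b`, but would equal `β^n * (b - a) > 0` if `b` lay in the interval of `a`. -/
theorem add_le_of_mem_fullStarts_of_lt (hβ : 1 < β) {n : ℕ} {a b : ℝ} (ha : a ∈ fullStarts β n)
    (hb : b ∈ fullStarts β n) (hab : a < b) : a + (β ^ n)⁻¹ ≤ b := by
  by_contra! h
  have hp : 0 < (β ^ n)⁻¹ := inv_pos.2 (pow_pos (by linarith) n)
  have h1 := ha.2.2 b hab.le h
  have h2 := hb.2.2 b le_rfl (by linarith)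
  rw [h1] at h2
  have : 0 < β ^ n := pow_pos (by linarith) n
  nlinarith

theorem floor_injOn_fullStarts (hβ : 1 < β) (n : ℕ) :
    Set.InjOn (fun a : ℝ => ⌊β ^ n * a⌋₊) (fullStarts β n) := by
  have hp : 0 < β ^ n := pow_pos (by linarith) n
  have key : ∀ a ∈ fullStarts β n, ∀ b ∈ fullStarts β n, a < b → ⌊β ^ n * a⌋₊ ≠ ⌊β ^ n * b⌋₊ := by
    intro a ha b hb hab
    have h1 : β ^ n * a + 1 ≤ β ^ n * b := by
      have := mul_le_mul_of_nonneg_left (add_le_of_mem_fullStarts_of_lt hβ ha hb hab) hp.le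
      rwa [mul_add, mul_inv_cancel₀ hp.ne'] at this
    have h2 := Nat.floor_mono h1
    rw [Nat.floor_add_one (mul_nonneg hp.le ha.1)] at h2
    omega
  intro a ha b hb hab
  rcases lt_trichotomy a b with h | h | h
  · exact (key a ha b hb h hab).elim
  · exact h
  · exact (key b hb a ha h hab.symm).elim

theorem floor_image_fullStarts_subset (hβ : 1 < β) (n : ℕ) :
    (fun a : ℝ => ⌊β ^ n * a⌋₊) '' fullStarts β n ⊆ Set.Iio ⌊β ^ n⌋₊ := by
  have hp : 0 < β ^ n := pow_pos (by linarith) n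
  rintro _ ⟨a, ha, rfl⟩
  have h1 : β ^ n * a + 1 ≤ β ^ n := by
    have := mul_le_mul_of_nonneg_left ha.2.1 hp.le
    rwa [mul_add, mul_inv_cancel₀ hp.ne', mul_one] at this
  have h2 := Nat.floor_mono h1
  rw [Nat.floor_add_one (mul_nonneg hp.le ha.1)] at h2
  exact h2

theorem finite_fullStarts (hβ : 1 < β) (n : ℕ) : (fullStarts β n).Finite :=
  Set.Finite.of_finite_image ((Set.finite_Iio _).subset (floor_image_fullStarts_subset hβ n))
    (floor_injOn_fullStarts hβ n)

theorem ncard_fullStarts_le (hβ : 1 < β) (n : ℕ) : ((fullStarts β n).ncard : ℝ) ≤ β ^ n := by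
  rw [← (floor_injOn_fullStarts hβ n).ncard_image]
  have h := Set.ncard_le_ncard (floor_image_fullStarts_subset hβ n) (Set.finite_Iio _)
  have h2 : (Set.Iio ⌊β ^ n⌋₊).ncard = ⌊β ^ n⌋₊ := by
    rw [← Finset.coe_Iio, Set.ncard_coe_finset, Nat.card_Iio]
  rw [h2] at h
  exact (Nat.cast_le.2 h).trans (Nat.floor_le (pow_nonneg (by linarith) n))

/-- Every cylinder of order `n` shares its right end point with a full cylinder of some order
`j ≤ n`, and its length is `T_β^(n - j) 1 / β ^ n`. -/
theorem exists_cylinder (hβ : 1 < β) {x : ℝ} (hx : x ∈ Set.Ico (0 : ℝ) 1) (n : ℕ) :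
    ∃ j k : ℕ, j + k = n ∧ ∃ a ∈ fullStarts β j, ∃ c : ℝ,
      c = a + (β ^ j)⁻¹ - (betaMap β)^[k] 1 * (β ^ n)⁻¹ ∧ 0 ≤ c ∧ c ≤ x ∧ x < a + (β ^ j)⁻¹ ∧
      ∀ y, c ≤ y → y < a + (β ^ j)⁻¹ → (betaMap β)^[n] y = β ^ n * (y - c) := by
  have hb : 0 < β := by linarith
  induction n with
  | zero =>
    exact ⟨0, 0, rfl, 0, zero_mem_fullStarts hβ 0, 0, by simp, le_rfl, hx.1, by simpa using hx.2,
      by simp⟩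
  | succ n ih =>
    obtain ⟨j, k, hjk, a, ha, c, hc, hc0, hcx, hxr, hT⟩ := ih
    set t := (betaMap β)^[k] 1 with ht
    set r := a + (β ^ j)⁻¹ with hr
    have hp : 0 < β ^ (n + 1) := by positivity
    have hpi : β ^ (n + 1) * (β ^ (n + 1))⁻¹ = 1 := mul_inv_cancel₀ hp.ne'
    have hr' : β ^ (n + 1) * (r - c) = β * t := by
      rw [hc]; field_simp; ring
    have hit : ∀ y, c ≤ y → y < r → ∀ d : ℤ, (d : ℝ) ≤ β ^ (n + 1) * (y - c) →
        β ^ (n + 1) * (y - c) < d + 1 →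
        (betaMap β)^[n + 1] y = β ^ (n + 1) * (y - (c + d * (β ^ (n + 1))⁻¹)) := by
      intro y h1 h2 d h3 h4
      have h5 : β * (β ^ n * (y - c)) = β ^ (n + 1) * (y - c) := by ring
      rw [Function.iterate_succ_apply', hT y h1 h2, betaMap_eq_of_floor (d := d) (by rwa [h5])
        (by rwa [h5]), h5]
      linear_combination (d : ℝ) * hpi
    set d : ℤ := ⌊β ^ (n + 1) * (x - c)⌋ with hd
    have hd1 : (d : ℝ) ≤ β ^ (n + 1) * (x - c) := Int.floor_le _
    have hd2 : β ^ (n + 1) * (x - c) < d + 1 := Int.lt_floor_add_one _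
    have hd0 : (0 : ℝ) ≤ d := by
      exact_mod_cast Int.floor_nonneg.2 (mul_nonneg hp.le (by linarith))
    have hdt : (d : ℝ) < β * t := by
      rw [← hr']
      exact hd1.trans_lt (by gcongr)
    have hcd : c ≤ c + d * (β ^ (n + 1))⁻¹ := by
      have : 0 ≤ d * (β ^ (n + 1))⁻¹ := by positivity
      linarith
    have hmul : ∀ y, β ^ (n + 1) * (y - c) = β ^ (n + 1) * (y - (c + d * (β ^ (n + 1))⁻¹)) + d := by
      intro y
      linear_combination (d : ℝ) * hpi
    have hcx' : c + d * (β ^ (n + 1))⁻¹ ≤ x := by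
      have := hmul x
      by_contra! h
      nlinarith
    -- The parent is mapped onto `[0, t)`. A child with a whole unit of `[0, β * t)` available is
    -- full and resets `k` to 0; otherwise it is the last, truncated child, which keeps the right
    -- end `r` and has `T t = β * t - d`.
    by_cases hfull : (d : ℝ) + 1 ≤ β * t
    · have hsub : c + d * (β ^ (n + 1))⁻¹ + (β ^ (n + 1))⁻¹ ≤ r := by
        have h1 := hmul r
        have : β ^ (n + 1) * (β ^ (n + 1))⁻¹ ≤
            β ^ (n + 1) * (r - (c + d * (β ^ (n + 1))⁻¹)) := by linarith
        have := le_of_mul_le_mul_left this hp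
        linarith
      have hmap : ∀ y, c + d * (β ^ (n + 1))⁻¹ ≤ y →
          y < c + d * (β ^ (n + 1))⁻¹ + (β ^ (n + 1))⁻¹ →
          (betaMap β)^[n + 1] y = β ^ (n + 1) * (y - (c + d * (β ^ (n + 1))⁻¹)) := by
        intro y h1 h2
        refine hit y (by linarith) (by linarith) d ?_ ?_
        · have := hmul y
          have : 0 ≤ β ^ (n + 1) * (y - (c + d * (β ^ (n + 1))⁻¹)) :=
            mul_nonneg hp.le (by linarith)
          linarith
        · rw [hmul y]
          have : β ^ (n + 1) * (y - (c + d * (β ^ (n + 1))⁻¹)) <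
              β ^ (n + 1) * (β ^ (n + 1))⁻¹ := by
            gcongr
            linarith
          linarith
      refine ⟨n + 1, 0, rfl, c + d * (β ^ (n + 1))⁻¹,
        ⟨by linarith, hsub.trans ha.2.1, hmap⟩, _, by simp, by linarith, hcx', ?_, hmap⟩
      have h1 := hmul x
      by_contra! h
      have : β ^ (n + 1) * (β ^ (n + 1))⁻¹ ≤
          β ^ (n + 1) * (x - (c + d * (β ^ (n + 1))⁻¹)) := by
        gcongr
        linarith
      linarith
    · push Not at hfull
      refine ⟨j, k + 1, by omega, a, ha, c + d * (β ^ (n + 1))⁻¹, ?_, by linarith, hcx', hxr, ?_⟩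
      · rw [Function.iterate_succ_apply', ← ht, betaMap_eq_of_floor hdt.le hfull, hc,
          ← hr]
        field_simp
        ring
      · intro y h1 h2
        refine hit y (by linarith) h2 d ?_ ?_
        · have := hmul y
          have : 0 ≤ β ^ (n + 1) * (y - (c + d * (β ^ (n + 1))⁻¹)) :=
            mul_nonneg hp.le (by linarith)
          linarith
        · refine lt_trans ?_ hfull
          rw [← hr']
          gcongr

/-- The convergents of order `n` of the points of `[0, 1)`. -/
def convergents (β : ℝ) (n : ℕ) : Set ℝ := (fun x => convergent β x n) '' Set.Ico 0 1

/-- A convergent is the left end of its cylinder, which is determined by the full cylinder sharing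
its right end. -/
theorem convergents_subset (hβ : 1 < β) (n : ℕ) :
    convergents β n ⊆ ⋃ j ∈ Finset.range (n + 1),
      (fun a => a + (β ^ j)⁻¹ - (betaMap β)^[n - j] 1 * (β ^ n)⁻¹) '' fullStarts β j := by
  rintro _ ⟨x, hx, rfl⟩
  obtain ⟨j, k, hjk, a, ha, c, hc, -, hcx, hxr, hT⟩ := exists_cylinder hβ hx n
  have hb : 0 < β := by linarith
  refine Set.mem_biUnion (x := j) (Finset.mem_coe.2 (Finset.mem_range.2 (by omega))) ⟨a, ha, ?_⟩
  have h1 := sub_convergent hb x n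
  rw [hT x hcx hxr, mul_div_cancel_left₀ _ (by positivity)] at h1
  have : n - j = k := by omega
  simp only [this]
  linarith

theorem finite_convergents (hβ : 1 < β) (n : ℕ) : (convergents β n).Finite :=
  (Set.Finite.biUnion (Finset.finite_toSet _) fun j _ => (finite_fullStarts hβ j).image _).subset
    (convergents_subset hβ n)

theorem ncard_convergents_le (hβ : 1 < β) (n : ℕ) :
    ((convergents β n).ncard : ℝ) ≤ (n + 1) * β ^ n := by
  have h1 := Set.ncard_le_ncard (convergents_subset hβ n)
    (Set.Finite.biUnion (Finset.finite_toSet _) fun j _ => (finite_fullStarts hβ j).image _)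
  have h2 : (⋃ j ∈ Finset.range (n + 1),
      (fun a => a + (β ^ j)⁻¹ - (betaMap β)^[n - j] 1 * (β ^ n)⁻¹) '' fullStarts β j).ncard ≤
      ∑ j ∈ Finset.range (n + 1), (fullStarts β j).ncard :=
    (Finset.set_ncard_biUnion_le _ _).trans
      (Finset.sum_le_sum fun j _ => Set.ncard_image_le (finite_fullStarts hβ j))
  have h3 : (((convergents β n).ncard : ℕ) : ℝ) ≤
      ∑ j ∈ Finset.range (n + 1), ((fullStarts β j).ncard : ℝ) := by exact_mod_cast h1.trans h2
  refine h3.trans ?_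
  calc _ ≤ ∑ j ∈ Finset.range (n + 1), β ^ n := by
        refine Finset.sum_le_sum fun j hj => (ncard_fullStarts_le hβ j).trans ?_
        exact pow_le_pow_right₀ hβ.le (by have := Finset.mem_range.1 hj; omega)
    _ = (n + 1) * β ^ n := by simp

/-- There are at least `β ^ n / (n + 1)` full cylinders of order `n`. -/
theorem le_ncard_fullStarts (hβ : 1 < β) (n : ℕ) :
    β ^ n ≤ (n + 1) * ((fullStarts β n).ncard : ℝ) := by
  have hb : 0 < β := by linarith
  have hp : 0 < β ^ n := by positivity
  -- Each cylinder has length at most `β^(-n)` and ends at `a + β^(-j)`, where `a` is also a full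
  -- start of order `n`; comparing total lengths gives the count.
  have hcov : Set.Ico (0 : ℝ) 1 ⊆ ⋃ j ∈ Finset.range (n + 1),
      ⋃ a ∈ (finite_fullStarts hβ n).toFinset,
        Set.Ico (a + (β ^ j)⁻¹ - (β ^ n)⁻¹) (a + (β ^ j)⁻¹) := by
    intro x hx
    obtain ⟨j, k, hjk, a, ha, c, hc, -, hcx, hxr, -⟩ := exists_cylinder hβ hx n
    refine Set.mem_biUnion (x := j) (Finset.mem_coe.2 (Finset.mem_range.2 (by omega))) ?_
    refine Set.mem_biUnion (x := a) ?_ ⟨?_, hxr⟩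
    · simpa using fullStarts_mono hβ (by omega : j ≤ n) ha
    · have h1 := (iterate_betaMap_one_mem_Icc (β := β) k).2
      have : 0 < (β ^ n)⁻¹ := by positivity
      nlinarith
  have h1 : MeasureTheory.volume (Set.Ico (0 : ℝ) 1) ≤
      ∑ j ∈ Finset.range (n + 1), ∑ a ∈ (finite_fullStarts hβ n).toFinset,
        ENNReal.ofReal (β ^ n)⁻¹ := by
    refine (MeasureTheory.measure_mono hcov).trans
      ((MeasureTheory.measure_biUnion_finset_le _ _).trans (Finset.sum_le_sum fun j _ => ?_))
    refine (MeasureTheory.measure_biUnion_finset_le _ _).trans (Finset.sum_le_sum fun a _ => ?_)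
    rw [Real.volume_Ico]
    simp
  simp only [Finset.sum_const, Finset.card_range, Real.volume_Ico, sub_zero] at h1
  rw [← Set.ncard_eq_toFinset_card _ (finite_fullStarts hβ n), ← ENNReal.ofReal_nsmul,
    ← ENNReal.ofReal_nsmul, ENNReal.ofReal_le_ofReal_iff (by positivity)] at h1
  simp only [nsmul_eq_mul, Nat.cast_add, Nat.cast_one] at h1
  rw [← mul_assoc, ← div_eq_mul_inv, le_div_iff₀ hp] at h1
  linarith

end Full

/-! ### The empty case and the upper bound by covering -/

section UpperBound

open MeasureTheory Topology

variable {β : ℝ}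

theorem inv_mul_elogb_le_iff (hβ : 1 < β) {f : ℝ} (hf : 0 < f) (y r : ℝ) :
    ((1 / f : ℝ) : EReal) * elogb β y ≤ (r : EReal) ↔ y ≤ β ^ (r * f) := by
  have hpos : 0 < β ^ (r * f) := Real.rpow_pos_of_pos (by linarith) _
  rw [elogb]
  split_ifs with hy
  · rw [← EReal.coe_mul, EReal.coe_le_coe_iff, ← Real.logb_le_iff_le_rpow hβ hy, one_div,
      inv_mul_le_iff₀ hf, mul_comm]
  · rw [EReal.coe_mul_bot_of_pos (by positivity)]
    simp only [bot_le, true_iff]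
    linarith

theorem inv_mul_elogb_lt_iff (hβ : 1 < β) {f : ℝ} (hf : 0 < f) (y r : ℝ) :
    ((1 / f : ℝ) : EReal) * elogb β y < (r : EReal) ↔ y < β ^ (r * f) := by
  have hpos : 0 < β ^ (r * f) := Real.rpow_pos_of_pos (by linarith) _
  rw [elogb]
  split_ifs with hy
  · rw [← EReal.coe_mul, EReal.coe_lt_coe_iff, ← Real.logb_lt_iff_lt_rpow hβ hy, one_div,
      inv_mul_lt_iff₀ hf, mul_comm]
  · rw [EReal.coe_mul_bot_of_pos (by positivity)]
    simp only [EReal.bot_lt_coe, true_iff]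
    linarith

theorem sub_convergent_le (hβ : 1 < β) {x : ℝ} (hx : x ∈ Set.Ico (0 : ℝ) 1) (n : ℕ) :
    x - convergent β x n ≤ (β ^ n)⁻¹ := by
  have hb : 0 < β := by linarith
  rw [sub_convergent hb, div_eq_mul_inv]
  exact mul_le_of_le_one_left (by positivity) (iterate_betaMap_mem_Ico hx n).2.le

theorem approxSet_eq_empty (hβ : 1 < β) {φ : ℕ → ℝ} (hφ : ∀ n : ℕ, 1 ≤ n → 0 < φ n)
    (h : lowerRate φ < 1) : approxSet β φ = ∅ := by
  obtain ⟨c, hc, hc1⟩ := exists_between h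
  have hct : c ≠ ⊤ := (hc1.trans ENNReal.one_lt_top).ne
  have hc1' : c.toReal < 1 := by
    rw [← ENNReal.toReal_one]
    exact (ENNReal.toReal_lt_toReal hct ENNReal.one_ne_top).2 hc1
  have hfreq : ∃ᶠ n : ℕ in atTop, ENNReal.ofReal (φ n / n) < c :=
    frequently_lt_of_liminf_lt (by isBoundedDefault) hc
  rw [Set.eq_empty_iff_forall_notMem]
  rintro x ⟨hx, hlim⟩
  have hc0 : 0 < c.toReal := ENNReal.toReal_pos (bot_le.trans_lt hc).ne' hct
  have hle : liminf (fun n : ℕ => ((1 / φ n : ℝ) : EReal) * elogb β (x - convergent β x n)) atTop ≤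
      ((-(c.toReal)⁻¹ : ℝ) : EReal) := by
    refine liminf_le_of_frequently_le ((hfreq.and_eventually (eventually_ge_atTop 1)).mono ?_)
      (by isBoundedDefault)
    rintro n ⟨h1, hn⟩
    have hn0 : (0 : ℝ) < n := by exact_mod_cast hn
    rw [inv_mul_elogb_le_iff hβ (hφ n hn)]
    refine (sub_convergent_le hβ hx n).trans ?_
    rw [← Real.rpow_natCast, ← Real.rpow_neg (by linarith), Real.rpow_le_rpow_left_iff hβ]
    have h2 : φ n / n < c.toReal :=
      (ENNReal.ofReal_lt_iff_lt_toReal (div_nonneg (hφ n hn).le hn0.le) hct).1 h1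
    rw [div_lt_iff₀ hn0] at h2
    have : (c.toReal)⁻¹ * φ n ≤ n := by
      rw [inv_mul_le_iff₀ hc0]; exact h2.le
    linarith
  rw [hlim, show (-1 : EReal) = ((-1 : ℝ) : EReal) by simp, EReal.coe_le_coe_iff] at hle
  have := one_lt_inv₀ hc0 |>.2 hc1'
  linarith

/-- The set of points that are `σ ^ n`-close to their `n`-th convergent for infinitely many `n` is
null for the Hausdorff measure of any dimension `d` with `β * σ ^ d < 1`. -/
theorem hausdorffMeasure_eq_zero_of_frequently (hβ : 1 < β) {σ d : ℝ} (hσ : 0 < σ) (hσ1 : σ < 1)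
    (h : β * σ ^ d < 1) {S : Set ℝ} (hS : S ⊆ Set.Ico 0 1)
    (hfreq : ∀ x ∈ S, ∃ᶠ n in atTop, x - convergent β x n ≤ σ ^ n) : μH[d] S = 0 := by
  have hb : 0 < β := by linarith
  have hcount : ∀ n, Countable (convergents β n) := fun n =>
    (finite_convergents hβ n).countable.to_subtype
  have hfin : ∀ n, Finite (convergents β n) := fun n => (finite_convergents hβ n).to_subtype
  set ρ := β * σ ^ d with hρ
  have hρ0 : 0 < ρ := by positivity
  have hdiam : ∀ (c : ℝ) (n : ℕ), Metric.ediam (Set.Icc c (c + σ ^ n)) = ENNReal.ofReal (σ ^ n) := by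
    intro c n
    rw [Real.ediam_Icc, add_sub_cancel_left]
  -- For every `m`, the intervals `[c, c + σ^n]` with `n ≥ m` and `c` a convergent of order `n`
  -- cover `S`; their sum is a tail of `∑ (n + 1) * ρ^n`.
  have hle := Measure.hausdorffMeasure_le_liminf_tsum (ι := fun m : ℕ => Σ n, convergents β (n + m))
    d S (l := atTop) (fun m => ENNReal.ofReal (σ ^ m)) (by
      rw [← ENNReal.ofReal_zero]
      exact ENNReal.tendsto_ofReal (tendsto_pow_atTop_nhds_zero_of_lt_one hσ.le hσ1))
    (fun m i => Set.Icc (i.2 : ℝ) (i.2 + σ ^ (i.1 + m)))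
    (Eventually.of_forall fun m i => by
      rw [hdiam]
      exact ENNReal.ofReal_le_ofReal (pow_le_pow_of_le_one hσ.le hσ1.le (by omega)))
    (Eventually.of_forall fun m x hx => by
      obtain ⟨n, hn, hmn⟩ := ((hfreq x hx).and_eventually (eventually_ge_atTop m)).exists
      obtain ⟨k, rfl⟩ := Nat.exists_eq_add_of_le' hmn
      refine Set.mem_iUnion.2 ⟨⟨k, convergent β x (k + m), ⟨x, hS hx, rfl⟩⟩, ?_, ?_⟩
      · have h1 := sub_convergent hb x (k + m)
        have h2 : 0 ≤ (betaMap β)^[k + m] x / β ^ (k + m) :=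
          div_nonneg (iterate_betaMap_mem_Ico (hS hx) _).1 (by positivity)
        show convergent β x (k + m) ≤ x
        linarith
      · show x ≤ convergent β x (k + m) + σ ^ (k + m)
        linarith)
  have hsum : Summable fun n : ℕ => ((n : ℝ) + 1) * ρ ^ n := by
    have h1 := summable_pow_mul_geometric_of_norm_lt_one 1 (r := ρ)
      (by rwa [Real.norm_of_nonneg hρ0.le])
    have h2 := summable_geometric_of_lt_one hρ0.le h
    refine (h1.add h2).congr fun n => ?_
    ring
  have htail : Tendsto (fun m : ℕ => ∑' n : ℕ, ENNReal.ofReal (((n + m : ℕ) + 1) * ρ ^ (n + m)))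
      atTop (𝓝 0) :=
    ENNReal.tendsto_sum_nat_add (fun n : ℕ => ENNReal.ofReal (((n : ℝ) + 1) * ρ ^ n))
      (hsum.tsum_ofReal_ne_top)
  refine le_antisymm (hle.trans ?_) bot_le
  rw [← htail.liminf_eq]
  refine liminf_le_liminf (Eventually.of_forall fun m => ?_)
  rw [ENNReal.tsum_sigma']
  refine ENNReal.tsum_le_tsum fun n => ?_
  simp only [hdiam]
  rw [ENNReal.tsum_const, ENat.card_eq_coe_natCard, Nat.card_coe_set_eq,
    ENNReal.ofReal_rpow_of_pos (by positivity)]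
  have h3 := ncard_convergents_le hβ (n + m)
  calc _ = ENNReal.ofReal (((convergents β (n + m)).ncard : ℝ) * (σ ^ (n + m)) ^ d) := by
        rw [ENNReal.ofReal_mul (by positivity), ENNReal.ofReal_natCast]; rfl
    _ ≤ _ := by
        refine ENNReal.ofReal_le_ofReal ?_
        rw [hρ, mul_pow, ← mul_assoc, ← Real.rpow_natCast σ, ← Real.rpow_mul hσ.le,
          ← Real.rpow_natCast (σ ^ d), ← Real.rpow_mul hσ.le, mul_comm d]
        gcongr

/-- For `d > 1/η` there are `g < η` and `θ < 1` with `θ * g * d > 1`. Infinitely often the error is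
below `β^(-θ * φ n)`, hence below `σ^n` with `σ = β^(-θ * g)`, and `β * σ^d < 1`. -/
theorem dimH_approxSet_le (hβ : 1 < β) {φ : ℕ → ℝ} (hφ : ∀ n : ℕ, 1 ≤ n → 0 < φ n) :
    dimH (approxSet β φ) ≤ 1 / lowerRate φ := by
  refine dimH_le fun d hd => ?_
  by_contra! hlt
  have hd0 : (d : ENNReal) ≠ 0 := (bot_le.trans_lt hlt).ne'
  have hdpos : 0 < (d : ℝ) := by
    rw [NNReal.coe_pos, pos_iff_ne_zero]; exact_mod_cast hd0
  rw [one_div, ENNReal.inv_lt_iff_inv_lt] at hlt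
  obtain ⟨g, hg, hgη⟩ := ENNReal.lt_iff_exists_nnreal_btwn.1 hlt
  have hgd : 1 < (g : ℝ) * d := by
    have h1 : (d : ENNReal)⁻¹ * d < g * d :=
      ENNReal.mul_lt_mul_left hd0 ENNReal.coe_ne_top hg
    rw [ENNReal.inv_mul_cancel hd0 ENNReal.coe_ne_top] at h1
    exact_mod_cast h1
  have hg0 : 0 < (g : ℝ) := by
    by_contra! h
    nlinarith
  obtain ⟨θ, hθ, hθ1⟩ := exists_between (inv_lt_one_of_one_lt₀ hgd)
  have hθ0 : 0 < θ := lt_trans (by positivity) hθ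
  have hθg : 1 < θ * (g * d) := by
    rwa [inv_lt_iff_one_lt_mul₀ (by positivity)] at hθ
  have hb : 0 < β := by linarith
  have hev : ∀ᶠ n : ℕ in atTop, (g : ENNReal) < ENNReal.ofReal (φ n / n) :=
    eventually_lt_of_lt_liminf hgη
  have hzero : μH[(d : ℝ)] (approxSet β φ) = 0 := by
    refine hausdorffMeasure_eq_zero_of_frequently hβ (σ := β ^ (-(θ * g))) (by positivity)
      (Real.rpow_lt_one_of_one_lt_of_neg hβ (by nlinarith [mul_pos hθ0 hg0])) ?_
      (fun x hx => hx.1) ?_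
    · rw [← Real.rpow_mul hb.le, ← Real.rpow_one_add' hb.le (by nlinarith)]
      exact Real.rpow_lt_one_of_one_lt_of_neg hβ (by nlinarith)
    · rintro x ⟨hx, hlim⟩
      have hfr : ∃ᶠ n : ℕ in atTop, ((1 / φ n : ℝ) : EReal) * elogb β (x - convergent β x n) <
          ((-θ : ℝ) : EReal) := by
        refine frequently_lt_of_liminf_lt (by isBoundedDefault) ?_
        rw [hlim, show (-1 : EReal) = ((-1 : ℝ) : EReal) by simp, EReal.coe_lt_coe_iff]
        linarith
      refine (hfr.and_eventually (hev.and (eventually_ge_atTop 1))).mono ?_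
      rintro n ⟨h1, h2, hn⟩
      have hn0 : (0 : ℝ) < n := by exact_mod_cast hn
      rw [inv_mul_elogb_lt_iff hβ (hφ n hn)] at h1
      refine h1.le.trans ?_
      rw [← Real.rpow_natCast, ← Real.rpow_mul hb.le, Real.rpow_le_rpow_left_iff hβ]
      rw [ENNReal.lt_ofReal_iff_toReal_lt ENNReal.coe_ne_top, ENNReal.coe_toReal,
        lt_div_iff₀ hn0] at h2
      nlinarith
  rw [hzero] at hd
  exact ENNReal.zero_ne_top hd

end UpperBound

/-! ### Points built from full blocks -/

section Blocks

open Topology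

variable {β : ℝ} {L : ℕ}

/-- The point `∑ b i * β ^ (-(L + 1) i)` whose expansion is made of the blocks `b i`, the
blocks being left end points of full cylinders of order `L`. -/
def blockPoint (β : ℝ) (L : ℕ) (b : ℕ → ℝ) : ℝ := ∑' i, b i * ((β ^ (L + 1))⁻¹) ^ i

theorem inv_pow_succ_lt_one (hβ : 1 < β) (L : ℕ) : (β ^ (L + 1))⁻¹ < 1 :=
  inv_lt_one_of_one_lt₀ (one_lt_pow₀ hβ (by omega))

/-- With `q = β^(-(L + 1))`, distinct blocks start at least `β * q` apart while the tail after a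
block is below `q`; the extra digit thus leaves a gap `(β - 1) * q`. -/
theorem inv_pow_eq_mul (hβ : 1 < β) (L : ℕ) : (β ^ L)⁻¹ = β * (β ^ (L + 1))⁻¹ := by
  have : 0 < β := by linarith
  field_simp
  ring

theorem block_le (hβ : 1 < β) {a : ℝ} (ha : a ∈ fullStarts β L) :
    a ≤ 1 - β * (β ^ (L + 1))⁻¹ := by
  have := ha.2.1
  rw [inv_pow_eq_mul hβ] at this
  linarith

theorem summable_block (hβ : 1 < β) {b : ℕ → ℝ} (hb : ∀ i, b i ∈ fullStarts β L) :
    Summable fun i => b i * ((β ^ (L + 1))⁻¹) ^ i := by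
  have h0 : 0 < (β ^ (L + 1))⁻¹ := by
    have : 0 < β := by linarith
    positivity
  refine Summable.of_nonneg_of_le (fun i => mul_nonneg (hb i).1 (by positivity)) (fun i => ?_)
    (summable_geometric_of_lt_one h0.le (inv_pow_succ_lt_one hβ L))
  refine mul_le_of_le_one_left (by positivity) ?_
  have := block_le hβ (hb i)
  nlinarith

theorem blockPoint_mem_Ico (hβ : 1 < β) {b : ℕ → ℝ} (hb : ∀ i, b i ∈ fullStarts β L) :
    blockPoint β L b ∈ Set.Ico (0 : ℝ) 1 := by
  have hq0 : 0 < (β ^ (L + 1))⁻¹ := by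
    have : 0 < β := by linarith
    positivity
  have hq1 := inv_pow_succ_lt_one hβ L
  refine ⟨tsum_nonneg fun i => mul_nonneg (hb i).1 (by positivity), ?_⟩
  have h1 : blockPoint β L b ≤ ∑' i : ℕ, (1 - β * (β ^ (L + 1))⁻¹) * ((β ^ (L + 1))⁻¹) ^ i := by
    refine (summable_block hβ hb).tsum_le_tsum (fun i => ?_)
      ((summable_geometric_of_lt_one hq0.le hq1).mul_left _)
    exact mul_le_mul_of_nonneg_right (block_le hβ (hb i)) (by positivity)
  refine h1.trans_lt ?_
  rw [tsum_mul_left, tsum_geometric_of_lt_one hq0.le hq1, ← div_eq_mul_inv,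
    div_lt_one (by linarith)]
  nlinarith

theorem blockPoint_eq_sum_add (hβ : 1 < β) {b : ℕ → ℝ} (hb : ∀ i, b i ∈ fullStarts β L) (k : ℕ) :
    blockPoint β L b = ∑ i ∈ Finset.range k, b i * ((β ^ (L + 1))⁻¹) ^ i +
      ((β ^ (L + 1))⁻¹) ^ k * blockPoint β L fun i => b (i + k) := by
  rw [blockPoint, ← (summable_block hβ hb).sum_add_tsum_nat_add k, blockPoint, ← tsum_mul_left]
  congr 1
  refine tsum_congr fun i => ?_
  rw [pow_add]
  ring

theorem blockPoint_eq_add (hβ : 1 < β) {b : ℕ → ℝ} (hb : ∀ i, b i ∈ fullStarts β L) :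
    blockPoint β L b = b 0 + (β ^ (L + 1))⁻¹ * blockPoint β L fun i => b (i + 1) := by
  simpa using blockPoint_eq_sum_add hβ hb 1

theorem blockPoint_mem_Ico_block (hβ : 1 < β) {b : ℕ → ℝ} (hb : ∀ i, b i ∈ fullStarts β L) :
    blockPoint β L b ∈ Set.Ico (b 0) (b 0 + (β ^ (L + 1))⁻¹) := by
  have hq0 : 0 < (β ^ (L + 1))⁻¹ := by
    have : 0 < β := by linarith
    positivity
  have h := blockPoint_mem_Ico hβ fun i => hb (i + 1)
  rw [blockPoint_eq_add hβ hb]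
  constructor <;> nlinarith [h.1, h.2]

theorem iterate_betaMap_blockPoint (hβ : 1 < β) {b : ℕ → ℝ} (hb : ∀ i, b i ∈ fullStarts β L)
    (k : ℕ) : (betaMap β)^[(L + 1) * k] (blockPoint β L b) =
      blockPoint β L fun i => b (i + k) := by
  have hp : 0 < β ^ (L + 1) := by
    have : 0 < β := by linarith
    positivity
  induction k with
  | zero => simp
  | succ k ih =>
    have hb' : ∀ i, b (i + k) ∈ fullStarts β L := fun i => hb _
    have h := blockPoint_mem_Ico_block hβ hb'
    have hfull := fullStarts_subset_succ hβ L (hb' 0)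
    rw [mul_add, mul_one, add_comm, Function.iterate_add_apply, ih, hfull.2.2 _ h.1 h.2]
    conv_lhs => rw [blockPoint_eq_add hβ hb', add_sub_cancel_left, ← mul_assoc,
      mul_inv_cancel₀ hp.ne', one_mul]
    congr 1
    funext i
    congr 1
    omega

theorem le_abs_blockPoint_sub (hβ : 1 < β) {b b' : ℕ → ℝ} (hb : ∀ i, b i ∈ fullStarts β L)
    (hb' : ∀ i, b' i ∈ fullStarts β L) {k : ℕ} (hk : ∀ i < k, b i = b' i) (hne : b k ≠ b' k) :
    (β - 1) * (β ^ (L + 1))⁻¹ * ((β ^ (L + 1))⁻¹) ^ k ≤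
      |blockPoint β L b - blockPoint β L b'| := by
  have hβ0 : 0 < β := by linarith
  have hq0 : 0 < (β ^ (L + 1))⁻¹ := by positivity
  rw [blockPoint_eq_sum_add hβ hb k, blockPoint_eq_sum_add hβ hb' k,
    Finset.sum_congr rfl fun i hi => by rw [hk i (Finset.mem_range.1 hi)], add_sub_add_left_eq_sub,
    ← mul_sub, abs_mul, abs_of_pos (by positivity), mul_comm]
  refine mul_le_mul_of_nonneg_left ?_ (by positivity)
  have h := blockPoint_mem_Ico_block hβ fun i => hb (i + k)
  have h' := blockPoint_mem_Ico_block hβ fun i => hb' (i + k)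
  simp only [zero_add] at h h'
  rw [le_abs]
  rcases lt_or_gt_of_ne hne with hlt | hlt
  · have := add_le_of_mem_fullStarts_of_lt hβ (hb k) (hb' k) hlt
    rw [inv_pow_eq_mul hβ] at this
    right
    linarith [h.2, h'.1]
  · have := add_le_of_mem_fullStarts_of_lt hβ (hb' k) (hb k) hlt
    rw [inv_pow_eq_mul hβ] at this
    left
    linarith [h.1, h'.2]

theorem sub_convergent_blockPoint_le (hβ : 1 < β) {b : ℕ → ℝ} (hb : ∀ i, b i ∈ fullStarts β L)
    {p r : ℕ} (hpr : p ≤ r) (hz : ∀ i, p ≤ i → i < r → b i = 0) :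
    blockPoint β L b - convergent β (blockPoint β L b) ((L + 1) * p) ≤
      (β ^ ((L + 1) * r))⁻¹ := by
  have hβ0 : 0 < β := by linarith
  obtain ⟨k, rfl⟩ := Nat.exists_eq_add_of_le hpr
  rw [sub_convergent hβ0, iterate_betaMap_blockPoint hβ hb,
    blockPoint_eq_sum_add hβ (fun i => hb (i + p)) k, Finset.sum_eq_zero, zero_add]
  · have h := blockPoint_mem_Ico hβ fun i => hb (i + k + p)
    rw [mul_add, pow_add _ ((L + 1) * p), pow_mul _ _ k, mul_inv, div_eq_mul_inv, mul_comm, inv_pow]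
    refine mul_le_mul_of_nonneg_left ?_ (by positivity)
    exact mul_le_of_le_one_right (by positivity) h.2.le
  · intro i hi
    rw [hz (i + p) (by omega) (by have := Finset.mem_range.1 hi; omega), zero_mul]

/-- `T` expands by a factor at most `β`, so the remainder at time `n` cannot be small if a nonzero
block starts soon after; a nonzero full start is at least `β^(-L)`. -/
theorem le_sub_convergent_blockPoint (hβ : 1 < β) {b : ℕ → ℝ} (hb : ∀ i, b i ∈ fullStarts β L)
    {n m : ℕ} (hnm : n ≤ (L + 1) * m) (hm : b m ≠ 0) :
    (β ^ ((L + 1) * (m + 1)))⁻¹ ≤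
      blockPoint β L b - convergent β (blockPoint β L b) n := by
  have hβ0 : 0 < β := by linarith
  set x := blockPoint β L b with hx
  have hxI : x ∈ Set.Ico (0 : ℝ) 1 := blockPoint_mem_Ico hβ hb
  obtain ⟨k, hk⟩ := Nat.exists_eq_add_of_le' hnm
  have h1 : (betaMap β)^[(L + 1) * m] x ≤ β ^ k * (betaMap β)^[n] x := by
    rw [hk, Function.iterate_add_apply]
    exact iterate_betaMap_le hβ0 (iterate_betaMap_mem_Ico hxI n) k
  have h2 : (β ^ (L + 1))⁻¹ ≤ (betaMap β)^[(L + 1) * m] x := by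
    rw [hx, iterate_betaMap_blockPoint hβ hb]
    refine le_trans ?_ (blockPoint_mem_Ico_block hβ fun i => hb (i + m)).1
    have hpos : 0 < b m := (hb m).1.lt_of_ne' hm
    have := add_le_of_mem_fullStarts_of_lt hβ (zero_mem_fullStarts hβ L) (hb m) hpos
    rw [zero_add] at this ⊢
    exact (inv_anti₀ (by positivity) (pow_le_pow_right₀ hβ.le L.le_succ)).trans this
  rw [sub_convergent hβ0, mul_add, mul_one, pow_add, hk, pow_add, le_div_iff₀ (by positivity)]
  have h3 := h2.trans h1
  calc (β ^ k * β ^ n * β ^ (L + 1))⁻¹ * β ^ n = (β ^ k)⁻¹ * (β ^ (L + 1))⁻¹ := by field_simp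
    _ ≤ (β ^ k)⁻¹ * (β ^ k * (betaMap β)^[n] x) := by gcongr
    _ = _ := by field_simp

/-- If the zero blocks are those with index in `Z`, the runs of zeros being at most as long as
allowed by the ratio `h = lim inf φ n / n`, and of this length infinitely often where `φ n / n` is
close to `h`, then the point with these blocks belongs to `approxSet β φ`. -/
theorem blockPoint_mem_approxSet (hβ : 1 < β) {φ : ℕ → ℝ} (hφ : ∀ n : ℕ, 1 ≤ n → 0 < φ n)
    {h : ℝ} (hh : 1 ≤ h) (hev : ∀ g < h, ∀ᶠ n : ℕ in atTop, g * n ≤ φ n) {Z : Set ℕ}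
    (hgap : ∀ i : ℕ, ∃ m ∉ Z, i ≤ m ∧ (m : ℝ) ≤ h * i)
    (hrun : ∀ δ > 0, ∃ᶠ p : ℕ in atTop, φ ((L + 1) * p) ≤ (h + δ) * ((L + 1) * p) ∧
      ∀ i, p ≤ i → i < ⌊h * p⌋₊ → i ∈ Z)
    {b : ℕ → ℝ} (hb : ∀ i, b i ∈ fullStarts β L) (hbZ : ∀ i, b i = 0 ↔ i ∈ Z) :
    blockPoint β L b ∈ approxSet β φ := by
  have hβ0 : 0 < β := by linarith
  have hL : (0 : ℝ) < (L : ℝ) + 1 := by positivity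
  refine ⟨blockPoint_mem_Ico hβ hb, ?_⟩
  set x := blockPoint β L b with hx
  set u : ℕ → EReal := fun n => ((1 / φ n : ℝ) : EReal) * elogb β (x - convergent β x n) with hu
  have hupper : ∀ ε : ℝ, 0 < ε → ε < 1 → liminf u atTop ≤ ((-1 + ε : ℝ) : EReal) := by
    intro ε hε hε1
    refine liminf_le_of_frequently_le ?_ (by isBoundedDefault)
    have h1 : ∃ᶠ p : ℕ in atTop, u ((L + 1) * p) ≤ ((-1 + ε : ℝ) : EReal) := by
      refine ((hrun ε hε).and_eventually ((eventually_ge_atTop 1).and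
        (tendsto_natCast_atTop_atTop.eventually_ge_atTop (ε ^ 2)⁻¹))).mono ?_
      rintro p ⟨⟨hp1, hp2⟩, hp3, hp4⟩
      have hpos : 0 < φ ((L + 1) * p) := hφ _ (by nlinarith)
      rw [hu]
      dsimp only
      rw [inv_mul_elogb_le_iff hβ hpos]
      have hpr : p ≤ ⌊h * p⌋₊ := Nat.le_floor (by nlinarith [(Nat.cast_nonneg p : (0 : ℝ) ≤ p)])
      refine (sub_convergent_blockPoint_le hβ hb hpr fun i h1 h2 => (hbZ i).2 (hp2 i h1 h2)).trans ?_
      rw [← Real.rpow_natCast, ← Real.rpow_neg hβ0.le, Real.rpow_le_rpow_left_iff hβ]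
      have h2 : h * p < ⌊h * p⌋₊ + 1 := Nat.lt_floor_add_one _
      have h3 : 1 ≤ ε ^ 2 * p := by
        rwa [inv_le_iff_one_le_mul₀' (by positivity)] at hp4
      push_cast
      have h4 : (1 - ε) * φ ((L + 1) * p) ≤ (1 - ε) * ((h + ε) * ((L + 1) * p)) := by
        refine mul_le_mul_of_nonneg_left hp1 (by linarith)
      -- This uses `h ≥ 1`; the slack `ε^2 * p ≥ 1` then pays for the floor in the run length.
      have h5 : (1 - ε) * (h + ε) * p ≤ (h - ε ^ 2) * p := by
        refine mul_le_mul_of_nonneg_right ?_ (Nat.cast_nonneg p)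
        nlinarith
      have h6 : (1 - ε) * ((h + ε) * ((L + 1) * p)) ≤ (L + 1) * ⌊h * p⌋₊ := by
        have : (1 - ε) * ((h + ε) * ((L + 1) * p)) = (L + 1) * ((1 - ε) * (h + ε) * p) := by ring
        rw [this]
        refine mul_le_mul_of_nonneg_left ?_ hL.le
        linarith
      linarith
    have htend : Tendsto (fun p : ℕ => (L + 1) * p) atTop atTop :=
      tendsto_id.const_mul_atTop' (by omega)
    exact htend.frequently h1
  have hlower : ∀ ε : ℝ, 0 < ε → ε < 1 → ((-1 - ε : ℝ) : EReal) ≤ liminf u atTop := by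
    intro ε hε hε1
    refine le_liminf_of_le (by isBoundedDefault) ?_
    -- Since `(1 + ε) * (1 - ε / 2) = 1 + ε * (1 - ε) / 2`, this is the linear surplus that absorbs
    -- the rounding to whole blocks.
    have hc : 0 < h * (ε * (1 - ε) / 2) := by
      have : 0 < 1 - ε := by linarith
      positivity
    filter_upwards [hev (h * (1 - ε / 2)) (by nlinarith), eventually_ge_atTop 1,
      (tendsto_natCast_atTop_atTop.const_mul_atTop hc).eventually_ge_atTop
        ((h + 1) * ((L : ℝ) + 1))] with n h1 hn h2
    rw [← not_lt, inv_mul_elogb_lt_iff hβ (hφ n hn), not_lt]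
    -- The index is that of the first block starting strictly after position `n`.
    obtain ⟨m, hmZ, hm1, hm2⟩ := hgap (n / (L + 1) + 1)
    have hnm : n ≤ (L + 1) * m := by
      have h3 := Nat.div_add_mod n (L + 1)
      have h4 := Nat.mod_lt n (show 0 < L + 1 by omega)
      have h5 : (L + 1) * (n / (L + 1) + 1) ≤ (L + 1) * m := Nat.mul_le_mul_left _ hm1
      rw [mul_add, mul_one] at h5
      omega
    refine le_trans ?_ (le_sub_convergent_blockPoint hβ hb hnm fun h0 => hmZ ((hbZ m).1 h0))
    rw [← Real.rpow_natCast, ← Real.rpow_neg hβ0.le, Real.rpow_le_rpow_left_iff hβ]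
    push_cast at hm2 ⊢
    have h3 : ((L : ℝ) + 1) * ((n / (L + 1) : ℕ) : ℝ) ≤ n := by
      exact_mod_cast Nat.mul_div_le n (L + 1)
    have h4 : ((L : ℝ) + 1) * m ≤ h * n + h * (L + 1) := by
      calc ((L : ℝ) + 1) * m ≤ (L + 1) * (h * (((n / (L + 1) : ℕ) : ℝ) + 1)) := by gcongr
        _ = h * ((L + 1) * ((n / (L + 1) : ℕ) : ℝ)) + h * (L + 1) := by ring
        _ ≤ _ := by gcongr
    have h5 : (1 + ε) * (h * (1 - ε / 2) * n) ≤ (1 + ε) * φ n := by gcongr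
    have h6 : (1 + ε) * (h * (1 - ε / 2) * n) = h * n + h * (ε * (1 - ε) / 2) * n := by ring
    linarith
  have hε : Tendsto (fun k : ℕ => (1 : ℝ) / ((k : ℝ) + 1)) atTop (𝓝 0) :=
    tendsto_one_div_add_atTop_nhds_zero_nat
  have hεev : ∀ᶠ k : ℕ in atTop, (1 : ℝ) / ((k : ℝ) + 1) < 1 := hε.eventually_lt_const one_pos
  have hεpos : ∀ k : ℕ, 0 < (1 : ℝ) / ((k : ℝ) + 1) := fun k => by positivity
  refine le_antisymm ?_ ?_
  · have ht : Tendsto (fun k : ℕ => ((-1 + 1 / ((k : ℝ) + 1) : ℝ) : EReal)) atTop (𝓝 (-1)) := by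
      have := (continuous_coe_real_ereal.tendsto _).comp (hε.const_add (-1))
      simpa [Function.comp_def] using this
    exact ge_of_tendsto ht (hεev.mono fun k hk => hupper _ (hεpos k) hk)
  · have ht : Tendsto (fun k : ℕ => ((-1 - 1 / ((k : ℝ) + 1) : ℝ) : EReal)) atTop (𝓝 (-1)) := by
      have := (continuous_coe_real_ereal.tendsto _).comp (hε.const_sub (-1))
      simpa [Function.comp_def] using this
    exact le_of_tendsto ht (hεev.mono fun k hk => hlower _ (hεpos k) hk)

end Blocks

/-! ### Sparse runs of zero blocks -/

section ZeroRuns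

/-- The union of the runs `[p k, h * p k)` of indices. -/
def zeroRuns (h : ℝ) (p : ℕ → ℕ) : Set ℕ := {i | ∃ k, p k ≤ i ∧ i < ⌊h * p k⌋₊}

variable {h ε : ℝ} {p : ℕ → ℕ}

/-- If `i` lies in a run, the end of that run works: it is at most `h * p k ≤ h * i`, and the next
run starts later. -/
theorem exists_notMem_zeroRuns (hh : 1 ≤ h) (hp : StrictMono p)
    (hlt : ∀ k, ⌊h * p k⌋₊ < p (k + 1)) (i : ℕ) :
    ∃ m ∉ zeroRuns h p, i ≤ m ∧ (m : ℝ) ≤ h * i := by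
  by_cases hi : i ∈ zeroRuns h p
  · obtain ⟨k, hk1, hk2⟩ := hi
    refine ⟨⌊h * p k⌋₊, ?_, hk2.le, (Nat.floor_le (by positivity)).trans (by gcongr)⟩
    rintro ⟨l, hl1, hl2⟩
    rcases Nat.lt_or_ge k l with hkl | hkl
    · have := hp.monotone (show k + 1 ≤ l from hkl)
      have := hlt k
      omega
    · have h1 : h * p l ≤ h * p k := by
        have := hp.monotone hkl
        gcongr
      have := Nat.floor_mono h1
      omega
  · exact ⟨i, hi, le_rfl, by nlinarith [(Nat.cast_nonneg i : (0 : ℝ) ≤ i)]⟩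

-- All runs before `p k` end by `ε * p k`, and the current run, cut at `i`, contributes at most `(1
-- - 1/h) * i`, with near equality at its end.
open Classical in
theorem card_zeroRuns_le (hh : 1 ≤ h) (hε : 0 < ε) (hp : StrictMono p)
    (hsp : ∀ k, h * p k ≤ ε * p (k + 1)) (i : ℕ) :
    (((Finset.range i).filter (· ∈ zeroRuns h p)).card : ℝ) ≤ (1 - 1 / h + ε) * i := by
  have hh0 : 0 < h := by linarith
  have hh1 : 0 ≤ 1 - 1 / h := by
    rw [sub_nonneg, div_le_one hh0]; exact hh
  have hstart : ∀ k, (((Finset.range (p k)).filter (· ∈ zeroRuns h p)).card : ℝ) ≤ ε * p k := by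
    intro k
    cases k with
    | zero =>
      rw [Finset.filter_eq_empty_iff.2]
      · simp only [Finset.card_empty, Nat.cast_zero]; positivity
      · rintro j hj ⟨l, hl, -⟩
        have := hp.monotone l.zero_le
        have := Finset.mem_range.1 hj
        omega
    | succ k =>
      have hsub : (Finset.range (p (k + 1))).filter (· ∈ zeroRuns h p) ⊆
          Finset.range ⌊h * p k⌋₊ := by
        intro j hj
        obtain ⟨hj, l, hl1, hl2⟩ := Finset.mem_filter.1 hj
        rw [Finset.mem_range] at hj ⊢
        have hlk : l ≤ k := by
          by_contra! hkl
          have := hp.monotone (show k + 1 ≤ l from hkl)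
          omega
        refine hl2.trans_le (Nat.floor_mono ?_)
        have := hp.monotone hlk
        gcongr
      have h1 := Finset.card_le_card hsub
      rw [Finset.card_range] at h1
      exact ((Nat.cast_le.2 h1).trans (Nat.floor_le (by positivity))).trans (hsp k)
  rcases Nat.lt_or_ge (p 0) i with hi | hi
  · obtain ⟨k, hk1, hk2⟩ : ∃ k, p k < i ∧ i ≤ p (k + 1) := by
      by_contra! hcon
      have hall : ∀ k, p k < i := fun k => by
        induction k with
        | zero => exact hi
        | succ k ih => exact hcon k ih
      have := hall i
      have := hp.id_le i
      simp only [id] at this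
      omega
    have hsub : (Finset.range i).filter (· ∈ zeroRuns h p) ⊆
        (Finset.range (p k)).filter (· ∈ zeroRuns h p) ∪ Finset.Ico (p k) (min i ⌊h * p k⌋₊) := by
      intro j hj
      obtain ⟨hj, hjz⟩ := Finset.mem_filter.1 hj
      rw [Finset.mem_range] at hj
      rw [Finset.mem_union, Finset.mem_filter, Finset.mem_range, Finset.mem_Ico]
      rcases Nat.lt_or_ge j (p k) with h1 | h1
      · exact Or.inl ⟨h1, hjz⟩
      · refine Or.inr ⟨h1, lt_min hj ?_⟩
        obtain ⟨l, hl1, hl2⟩ := hjz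
        have hlk : l ≤ k := by
          by_contra! hkl
          have := hp.monotone (show k + 1 ≤ l from hkl)
          omega
        refine hl2.trans_le (Nat.floor_mono ?_)
        have := hp.monotone hlk
        gcongr
    have h1 := (Finset.card_le_card hsub).trans (Finset.card_union_le _ _)
    rw [Nat.card_Ico] at h1
    have hpr : p k ≤ ⌊h * p k⌋₊ :=
      Nat.le_floor (by nlinarith [(Nat.cast_nonneg (p k) : (0 : ℝ) ≤ p k)])
    have hmin : p k ≤ min i ⌊h * p k⌋₊ := le_min hk1.le hpr
    have h2 : (((Finset.range i).filter (· ∈ zeroRuns h p)).card : ℝ) ≤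
        ((Finset.range (p k)).filter (· ∈ zeroRuns h p)).card +
          (((min i ⌊h * p k⌋₊ : ℕ) : ℝ) - p k) := by
      rw [← Nat.cast_sub hmin]
      exact_mod_cast h1
    have h3 : ((min i ⌊h * p k⌋₊ : ℕ) : ℝ) ≤ i := by exact_mod_cast min_le_left _ _
    have h4 : ((min i ⌊h * p k⌋₊ : ℕ) : ℝ) ≤ h * p k :=
      (Nat.cast_le.2 (min_le_right _ _)).trans (Nat.floor_le (by positivity))
    have h5 : ((min i ⌊h * p k⌋₊ : ℕ) : ℝ) * (1 / h) ≤ p k := by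
      rw [mul_one_div, div_le_iff₀ hh0]; linarith
    have h6 : ((min i ⌊h * p k⌋₊ : ℕ) : ℝ) * (1 - 1 / h) ≤ i * (1 - 1 / h) := by gcongr
    have h7 : ε * p k ≤ ε * i := by gcongr
    linarith [hstart k]
  · rw [Finset.filter_eq_empty_iff.2]
    · simp only [Finset.card_empty, Nat.cast_zero]
      exact mul_nonneg (by linarith) (Nat.cast_nonneg _)
    · rintro j hj ⟨l, hl, -⟩
      have := hp.monotone l.zero_le
      have := Finset.mem_range.1 hj
      omega

open Classical in
/-- A sparse choice of runs starting at prescribed places leaves a proportion close to `1 / h` of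
the indices free. -/
theorem exists_zeroRuns (hh : 1 ≤ h) (hε : 0 < ε) {P : ℕ → ℕ → Prop}
    (hP : ∀ k, ∃ᶠ n in atTop, P k n) :
    ∃ Z : Set ℕ, (∀ i : ℕ, ∃ m ∉ Z, i ≤ m ∧ (m : ℝ) ≤ h * i) ∧
      (∃ p : ℕ → ℕ, Tendsto p atTop atTop ∧
        ∀ k, P k (p k) ∧ ∀ i, p k ≤ i → i < ⌊h * p k⌋₊ → i ∈ Z) ∧
      ∀ i : ℕ, (1 / h - ε) * i ≤ Nat.count (· ∉ Z) i := by
  have hnext : ∀ k n : ℕ, ∃ m : ℕ, ⌈h * n / ε⌉₊ + ⌊h * n⌋₊ + n + 1 ≤ m ∧ P k m := fun k n => by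
    obtain ⟨m, hm1, hm2⟩ := ((hP k).and_eventually (eventually_ge_atTop _)).exists
    exact ⟨m, hm2, hm1⟩
  choose next hn1 hn2 using hnext
  obtain ⟨p, hps⟩ : ∃ p : ℕ → ℕ, ∀ k, p (k + 1) = next k (p k) :=
    ⟨fun k => Nat.rec 0 next k, fun _ => rfl⟩
  have hle : ∀ k, ⌈h * (p k : ℝ) / ε⌉₊ + ⌊h * (p k : ℝ)⌋₊ + p k + 1 ≤ p (k + 1) :=
    fun k => by rw [hps]; exact hn1 k (p k)
  have hmono : StrictMono p := strictMono_nat_of_lt_succ fun k => by have := hle k; omega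
  have hlt : ∀ k, ⌊h * p k⌋₊ < p (k + 1) := fun k => by have := hle k; omega
  have hsp : ∀ k, h * p k ≤ ε * p (k + 1) := fun k => by
    have h1 : ⌈h * p k / ε⌉₊ ≤ p (k + 1) := by have := hle k; omega
    have h2 := (Nat.le_ceil (h * p k / ε)).trans (Nat.cast_le.2 h1)
    rwa [div_le_iff₀' hε] at h2
  -- The shift is needed because `p 0 = 0` is only a seed, with an empty run; `P k` is arranged at
  -- `p (k + 1)`.
  refine ⟨zeroRuns h p, exists_notMem_zeroRuns hh hmono hlt,
    ⟨fun k => p (k + 1), hmono.tendsto_atTop.comp (tendsto_add_atTop_nat 1), fun k =>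
      ⟨by simpa only [hps] using hn2 k (p k), fun i h1 h2 => ⟨k + 1, h1, h2⟩⟩⟩, fun i => ?_⟩
  have h1 := card_zeroRuns_le hh hε hmono hsp i
  have h2 := Finset.card_filter_add_card_filter_not (s := Finset.range i) (· ∈ zeroRuns h p)
  rw [Finset.card_range] at h2
  rw [Nat.count_eq_card_filter_range]
  have h3 : (((Finset.range i).filter (· ∈ zeroRuns h p)).card : ℝ) +
      ((Finset.range i).filter (· ∉ zeroRuns h p)).card = i := by exact_mod_cast h2
  linarith

end ZeroRuns

/-! ### Hölder coding and the lower bound -/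

section LowerBound

open Topology MeasureTheory

variable {β : ℝ}

/-- The hypothesis makes `f` injective with an `r`-Hölder inverse, which multiplies dimension by at
most `1/r`. -/
theorem le_dimH_image_of_abs_sub_le {f : ℝ → ℝ} {s : Set ℝ} {K r : ℝ} (hr : 0 < r) (hK : 0 ≤ K)
    (h : ∀ x ∈ s, ∀ y ∈ s, |x - y| ≤ K * |f x - f y| ^ r) :
    ENNReal.ofReal r * dimH s ≤ dimH (f '' s) := by
  have hinj : Set.InjOn f s := fun x hx y hy hxy => by
    have := h x hx y hy
    rw [hxy, sub_self, abs_zero, Real.zero_rpow hr.ne', mul_zero] at this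
    exact sub_eq_zero.1 (abs_nonpos_iff.1 this)
  have hg := hinj.leftInvOn_invFunOn
  have hH : HolderOnWith K.toNNReal r.toNNReal (Function.invFunOn f s) (f '' s) := by
    rintro _ ⟨x, hx, rfl⟩ _ ⟨y, hy, rfl⟩
    rw [hg hx, hg hy, edist_dist, edist_dist, Real.dist_eq, Real.dist_eq, Real.coe_toNNReal r hr.le,
      ENNReal.ofReal_rpow_of_nonneg (abs_nonneg _) hr.le]
    change _ ≤ ENNReal.ofReal K * _
    rw [← ENNReal.ofReal_mul hK]
    exact ENNReal.ofReal_le_ofReal (h x hx y hy)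
  have h1 := hH.dimH_image_le (Real.toNNReal_pos.2 hr)
  rw [Set.LeftInvOn.image_image hg] at h1
  have h2 := mul_le_mul_right h1 (ENNReal.ofReal r)
  refine h2.trans ?_
  exact ENNReal.mul_div_le

/-- For `s < 1` there are at least `β ^ (s (L + 1))` nonzero full starts of some order `L`. -/
theorem exists_rpow_le_ncard_fullStarts (hβ : 1 < β) {s : ℝ} (hs0 : 0 < s) (hs : s < 1) :
    ∃ L : ℕ, β ^ (s * (L + 1)) ≤ ((fullStarts β L \ {0}).ncard : ℝ) := by
  have hβ0 : 0 < β := by linarith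
  set τ := β ^ s with hτ
  have hτ0 : 0 < τ := by positivity
  have hτ1 : 1 < τ := Real.one_lt_rpow hβ hs0
  have hτβ : τ < β := by
    calc τ < β ^ (1 : ℝ) := Real.rpow_lt_rpow_of_exponent_lt hβ hs
      _ = β := Real.rpow_one β
  have hr0 : 0 ≤ τ / β := by positivity
  have hr1 : τ / β < 1 := (div_lt_one hβ0).2 hτβ
  -- A value below 1 gives at least `2 * τ^(L + 1)` full starts; the factor 2 pays for discarding 0,
  -- as `τ^(L + 1) ≥ 1`.
  have htend : Tendsto (fun n : ℕ => 2 * τ * ((n : ℝ) * (τ / β) ^ n + (τ / β) ^ n)) atTop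
      (𝓝 0) := by
    have := ((tendsto_self_mul_const_pow_of_lt_one hr0 hr1).add
      (tendsto_pow_atTop_nhds_zero_of_lt_one hr0 hr1)).const_mul (2 * τ)
    simpa using this
  obtain ⟨L, hL⟩ := (htend.eventually_lt_const one_pos).exists
  refine ⟨L, ?_⟩
  have h1 := le_ncard_fullStarts hβ L
  have h2 : ((fullStarts β L \ {0}).ncard : ℝ) = (fullStarts β L).ncard - 1 := by
    have := Set.ncard_sdiff_singleton_add_one (zero_mem_fullStarts hβ L) (finite_fullStarts hβ L)
    rw [← this]
    push_cast
    ring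
  have h3 : β ^ (s * (L + 1)) = τ ^ (L + 1) := by
    rw [hτ, ← Real.rpow_natCast, ← Real.rpow_mul hβ0.le]
    push_cast
    rfl
  rw [h2, h3]
  have h4 : 2 * τ * (L + 1) * τ ^ L < β ^ L := by
    have h5 : 2 * τ * ((L : ℝ) * (τ / β) ^ L + (τ / β) ^ L) = 2 * τ * (L + 1) * τ ^ L / β ^ L := by
      rw [div_pow]; ring
    rw [h5, div_lt_one (by positivity)] at hL
    exact hL
  have h6 : (1 : ℝ) ≤ τ ^ (L + 1) := one_le_pow₀ hτ1.le
  have h7 : ((L : ℝ) + 1) * (2 * τ ^ (L + 1)) ≤ (L + 1) * (fullStarts β L).ncard := by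
    rw [pow_succ]; linarith
  have h8 := le_of_mul_le_mul_left h7 (by positivity)
  linarith

open Classical in
/-- The block sequence that writes the base `M` digits of `t`, through `a`, on the indices outside
`Z`, and `0` on `Z`. -/
def digitBlocks (Z : Set ℕ) (a : ℕ → ℝ) (M : ℕ) (t : ℝ) (i : ℕ) : ℝ :=
  if i ∈ Z then 0 else a (digit M t (Nat.count (· ∉ Z) i)).toNat

theorem digit_nonneg_lt {M : ℕ} {t : ℝ} (hM : 0 < M) (ht : t ∈ Set.Ico (0 : ℝ) 1) (k : ℕ) :
    0 ≤ digit M t k ∧ digit M t k < M := by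
  have h := iterate_betaMap_mem_Ico (β := (M : ℝ)) ht k
  have hM' : (0 : ℝ) < M := by exact_mod_cast hM
  refine ⟨Int.floor_nonneg.2 (mul_nonneg hM'.le h.1), Int.floor_lt.2 ?_⟩
  push_cast
  nlinarith [h.2]

-- The digit `k` is written at the free index number `k`, which is below `i` when `k` is below the
-- count.
open Classical in
theorem digit_eq_of_digitBlocks_eq {Z : Set ℕ} (hZ : ∀ i, ∃ m ∉ Z, i ≤ m) {a : ℕ → ℝ} {M : ℕ}
    (hM : 0 < M) (ha : Set.InjOn a (Set.Iio M)) {t t' : ℝ} (ht : t ∈ Set.Ico (0 : ℝ) 1)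
    (ht' : t' ∈ Set.Ico (0 : ℝ) 1) {i : ℕ}
    (h : ∀ j < i, digitBlocks Z a M t j = digitBlocks Z a M t' j) {k : ℕ}
    (hk : k < Nat.count (· ∉ Z) i) : digit M t k = digit M t' k := by
  have hinf : (Set.ofPred (· ∉ Z)).Infinite := Set.infinite_of_forall_exists_gt fun i => by
    obtain ⟨m, h1, h2⟩ := hZ (i + 1)
    exact ⟨m, h1, h2⟩
  have h1 := h _ (Nat.nth_lt_of_lt_count hk)
  have h2 : Nat.nth (· ∉ Z) k ∉ Z := Nat.nth_mem_of_infinite hinf k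
  simp only [digitBlocks, if_neg h2, Nat.count_nth_of_infinite hinf] at h1
  have h3 := digit_nonneg_lt hM ht k
  have h4 := digit_nonneg_lt hM ht' k
  have h5 := ha (Set.mem_Iio.2 (by omega)) (Set.mem_Iio.2 (by omega)) h1
  omega

open Classical in
/-- The Hölder estimate for the inverse of the coding `t ↦ blockPoint β L (digitBlocks Z a M t)`. -/
theorem abs_sub_le_blockPoint_digitBlocks (hβ : 1 < β) {L M : ℕ} {s κ : ℝ} (hs : 0 < s)
    (hκ : 0 < κ) (hM : β ^ (s * (L + 1)) ≤ M) {Z : Set ℕ} (hZ : ∀ i, ∃ m ∉ Z, i ≤ m)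
    (hcount : ∀ i : ℕ, κ * i ≤ Nat.count (· ∉ Z) i) {a : ℕ → ℝ} (ha : Set.InjOn a (Set.Iio M))
    {t t' : ℝ} (ht : t ∈ Set.Ico (0 : ℝ) 1) (ht' : t' ∈ Set.Ico (0 : ℝ) 1)
    (hb : ∀ i, digitBlocks Z a M t i ∈ fullStarts β L)
    (hb' : ∀ i, digitBlocks Z a M t' i ∈ fullStarts β L) :
    |t - t'| ≤ (((β - 1) * (β ^ (L + 1))⁻¹)⁻¹) ^ (s * κ) *
      |blockPoint β L (digitBlocks Z a M t) - blockPoint β L (digitBlocks Z a M t')| ^ (s * κ) := by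
  have hβ0 : 0 < β := by linarith
  have hM1 : (1 : ℝ) < M := (Real.one_lt_rpow hβ (by positivity)).trans_le hM
  have hM0 : 0 < M := by
    have : (0 : ℝ) < M := by linarith
    exact_mod_cast this
  have hc : 0 < (β - 1) * (β ^ (L + 1))⁻¹ := mul_pos (by linarith) (by positivity)
  -- Agreement on `i` blocks means agreement on at least `κ * i` base `M` digits, and `M ≥ β^(s * (L
  -- + 1))`.
  have hbound : ∀ i : ℕ, (∀ j < i, digitBlocks Z a M t j = digitBlocks Z a M t' j) →
      |t - t'| ≤ (((β ^ (L + 1))⁻¹) ^ i) ^ (s * κ) := by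
    intro i hi
    refine (abs_sub_le_of_digit_eq (by linarith) ht ht' fun k hk =>
      digit_eq_of_digitBlocks_eq hZ hM0 ha ht ht' hi hk).trans ?_
    have h1 : (β ^ (s * (L + 1))) ^ (κ * i) ≤ (M : ℝ) ^ (Nat.count (· ∉ Z) i) := by
      rw [← Real.rpow_natCast (M : ℝ)]
      calc (β ^ (s * (L + 1))) ^ (κ * i) ≤ (M : ℝ) ^ (κ * i) := by gcongr
        _ ≤ _ := Real.rpow_le_rpow_of_exponent_le hM1.le (hcount i)
    refine (inv_anti₀ (by positivity) h1).trans (le_of_eq ?_)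
    rw [← inv_pow, ← pow_mul, inv_pow, Real.inv_rpow (by positivity), ← Real.rpow_natCast,
      ← Real.rpow_mul hβ0.le, ← Real.rpow_mul hβ0.le]
    congr 2
    push_cast
    ring
  by_cases hex : ∃ i, digitBlocks Z a M t i ≠ digitBlocks Z a M t' i
  · have hmin : ∀ j < Nat.find hex, digitBlocks Z a M t j = digitBlocks Z a M t' j := fun j hj => by
      have := Nat.find_min hex hj
      push Not at this
      exact this
    refine (hbound _ hmin).trans ?_
    rw [← Real.mul_rpow (by positivity) (abs_nonneg _)]
    have h1 := le_abs_blockPoint_sub hβ hb hb' hmin (Nat.find_spec hex)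
    refine Real.rpow_le_rpow (by positivity) ?_ (by positivity)
    rwa [le_inv_mul_iff₀ hc]
  · push Not at hex
    have h0 : |t - t'| ≤ 0 := by
      have htend : Tendsto (fun i : ℕ => (((β ^ (L + 1))⁻¹) ^ i) ^ (s * κ)) atTop (𝓝 0) := by
        have h1 := tendsto_pow_atTop_nhds_zero_of_lt_one (r := (β ^ (L + 1))⁻¹) (by positivity)
          (inv_pow_succ_lt_one hβ L)
        have h2 := h1.rpow_const (p := s * κ) (Or.inr (by positivity))
        rwa [Real.zero_rpow (by positivity)] at h2
      exact ge_of_tendsto' htend fun i => hbound i fun j _ => hex j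
    exact h0.trans (by positivity)

open Classical in
theorem le_dimH_approxSet (hβ : 1 < β) {φ : ℕ → ℝ} (hφ : ∀ n : ℕ, 1 ≤ n → 0 < φ n) {h : ℝ}
    (hh : 1 ≤ h) (hev : ∀ g < h, ∀ᶠ n : ℕ in atTop, g * n ≤ φ n)
    (hfr : ∀ N : ℕ, 0 < N → ∀ δ > 0, ∃ᶠ p : ℕ in atTop, φ (N * p) ≤ (h + δ) * (N * p)) {r : ℝ}
    (hr0 : 0 < r) (hr : r < 1 / h) : ENNReal.ofReal r ≤ dimH (approxSet β φ) := by
  -- Here `κ` is the guaranteed proportion of free blocks and `s = r / κ < 1` the loss from counting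
  -- full cylinders; the Hölder exponent is `s * κ = r`.
  obtain ⟨κ, hκr, hκ⟩ := exists_between hr
  have hκ0 : 0 < κ := hr0.trans hκr
  have hs0 : 0 < r / κ := by positivity
  have hs1 : r / κ < 1 := (div_lt_one hκ0).2 hκr
  obtain ⟨L, hL⟩ := exists_rpow_le_ncard_fullStarts hβ hs0 hs1
  have hfin : (fullStarts β L \ {0}).Finite := (finite_fullStarts hβ L).sdiff
  -- Excluding 0 keeps every free block nonzero, so no zero run is longer than planned.
  set M := (fullStarts β L \ {0}).ncard with hM
  obtain ⟨a, ha, hainj⟩ : ∃ a : ℕ → ℝ, (∀ j < M, a j ∈ fullStarts β L \ {0}) ∧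
      Set.InjOn a (Set.Iio M) := by
    have hcard : hfin.toFinset.card = M := (Set.ncard_eq_toFinset_card _ hfin).symm
    let e := hfin.toFinset.equivFinOfCardEq hcard
    refine ⟨fun j => if hj : j < M then e.symm ⟨j, hj⟩ else 0, fun j hj => ?_, ?_⟩
    · simp only [dif_pos hj]
      exact hfin.mem_toFinset.1 (e.symm ⟨j, hj⟩).2
    · intro i hi j hj hij
      simp only [dif_pos (Set.mem_Iio.1 hi), dif_pos (Set.mem_Iio.1 hj)] at hij
      simpa using e.symm.injective (Subtype.ext hij)
  obtain ⟨Z, hgap, ⟨p, hp, hpZ⟩, hcount⟩ := exists_zeroRuns hh (ε := 1 / h - κ) (by linarith)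
    (P := fun k n => φ ((L + 1) * n) ≤ (h + 1 / ((k : ℝ) + 1)) * ((L + 1) * n))
    (fun k => by simpa using hfr (L + 1) (by omega) (1 / ((k : ℝ) + 1)) (by positivity))
  have hM0 : 0 < M := by
    have : (0 : ℝ) < M := lt_of_lt_of_le (Real.rpow_pos_of_pos (by linarith) _) hL
    exact_mod_cast this
  have hdig : ∀ t ∈ Set.Ico (0 : ℝ) 1, ∀ k, (digit M t k).toNat < M := fun t ht k => by
    have := digit_nonneg_lt hM0 ht k
    omega
  have hb : ∀ t ∈ Set.Ico (0 : ℝ) 1, ∀ i, digitBlocks Z a M t i ∈ fullStarts β L := by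
    intro t ht i
    rw [digitBlocks]
    split_ifs
    · exact zero_mem_fullStarts hβ L
    · exact (ha _ (hdig t ht _)).1
  have hbZ : ∀ t ∈ Set.Ico (0 : ℝ) 1, ∀ i, digitBlocks Z a M t i = 0 ↔ i ∈ Z := by
    intro t ht i
    rw [digitBlocks]
    split_ifs with hi
    · simp [hi]
    · simp only [hi, iff_false]
      exact (ha _ (hdig t ht _)).2
  have hrun : ∀ δ > 0, ∃ᶠ n : ℕ in atTop, φ ((L + 1) * n) ≤ (h + δ) * ((L + 1) * n) ∧
      ∀ i, n ≤ i → i < ⌊h * n⌋₊ → i ∈ Z := by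
    intro δ hδ
    refine hp.frequently (Eventually.frequently ?_)
    filter_upwards [tendsto_one_div_add_atTop_nhds_zero_nat.eventually_lt_const hδ] with k hk
    refine ⟨(hpZ k).1.trans ?_, (hpZ k).2⟩
    gcongr
  have hsub : (fun t => blockPoint β L (digitBlocks Z a M t)) '' Set.Ico (0 : ℝ) 1 ⊆
      approxSet β φ := by
    rintro _ ⟨t, ht, rfl⟩
    exact blockPoint_mem_approxSet hβ hφ hh hev hgap hrun (hb t ht) (hbZ t ht)
  refine le_trans ?_ (dimH_mono hsub)
  have hc : 0 < (β - 1) * (β ^ (L + 1))⁻¹ := by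
    have : 0 < β := by linarith
    exact mul_pos (by linarith) (by positivity)
  have hmain := le_dimH_image_of_abs_sub_le (s := Set.Ico (0 : ℝ) 1)
    (f := fun t => blockPoint β L (digitBlocks Z a M t))
    (K := (((β - 1) * (β ^ (L + 1))⁻¹)⁻¹) ^ (r / κ * κ)) (r := r / κ * κ)
    (by positivity) (by positivity) fun t ht t' ht' =>
      abs_sub_le_blockPoint_digitBlocks hβ hs0 hκ0 hL
        (fun i => (hgap i).imp fun m hm => ⟨hm.1, hm.2.1⟩) (by simpa using hcount) hainj ht ht'
        (hb t ht) (hb t' ht')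
  have hdim : dimH (Set.Ico (0 : ℝ) 1) = 1 := by
    rw [Real.dimH_of_nonempty_interior (by simp)]
    simp
  rwa [hdim, mul_one, div_mul_cancel₀ _ hκ0.ne'] at hmain

end LowerBound

end BetaExpansion
end

theorem theorem2 (β : ℝ) (hβ : 1 < β) (φ : ℕ → ℝ) (hφ : ∀ n : ℕ, 1 ≤ n → 0 < φ n) :
    (BetaExpansion.lowerRate φ < 1 → BetaExpansion.approxSet β φ = ∅) ∧
    (MonotoneOn φ (Set.Ici 1) → 1 ≤ BetaExpansion.lowerRate φ →
      dimH (BetaExpansion.approxSet β φ) = 1 / BetaExpansion.lowerRate φ) := by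
  refine ⟨BetaExpansion.approxSet_eq_empty hβ hφ, fun hmono hη => ?_⟩
  refine le_antisymm (BetaExpansion.dimH_approxSet_le hβ hφ) ?_
  rcases eq_or_ne (BetaExpansion.lowerRate φ) ⊤ with htop | htop
  · simp [htop]
  set h := (BetaExpansion.lowerRate φ).toReal with hdef
  have hrate : BetaExpansion.lowerRate φ = ENNReal.ofReal h := (ENNReal.ofReal_toReal htop).symm
  have hh : 1 ≤ h := by
    rw [hrate] at hη
    exact ENNReal.one_le_ofReal.1 hη
  have hh0 : 0 < h := by linarith
  have hev : ∀ g < h, ∀ᶠ n : ℕ in atTop, g * n ≤ φ n := by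
    intro g hg
    have h1 : ENNReal.ofReal g < BetaExpansion.lowerRate φ := by
      rw [hrate]; exact (ENNReal.ofReal_lt_ofReal_iff hh0).2 hg
    filter_upwards [eventually_lt_of_lt_liminf h1, eventually_ge_atTop 1] with n h2 hn
    have hn0 : (0 : ℝ) < n := by exact_mod_cast hn
    rw [← le_div_iff₀ hn0]
    exact (ENNReal.ofReal_lt_ofReal_iff (div_pos (hφ n hn) hn0)).1 h2 |>.le
  -- Zero runs start at block boundaries, so good `n` are rounded down to multiples of `N`.
  -- Monotonicity of `φ` allows this, and for large `n` the rounding costs at most `δ / 2` in the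
  -- ratio.
  have hfr : ∀ N : ℕ, 0 < N → ∀ δ > 0, ∃ᶠ p : ℕ in atTop, φ (N * p) ≤ (h + δ) * (N * p) := by
    intro N hN δ hδ
    have hN0 : (0 : ℝ) < N := by exact_mod_cast hN
    have h1 : BetaExpansion.lowerRate φ < ENNReal.ofReal (h + δ / 2) := by
      rw [hrate]; exact (ENNReal.ofReal_lt_ofReal_iff (by linarith)).2 (by linarith)
    have h2 : ∃ᶠ n : ℕ in atTop, ENNReal.ofReal (φ n / n) < ENNReal.ofReal (h + δ / 2) :=
      frequently_lt_of_liminf_lt (by isBoundedDefault) h1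
    refine (Nat.tendsto_div_const_atTop hN.ne').frequently
      ((h2.and_eventually (((Nat.tendsto_div_const_atTop hN.ne').eventually_ge_atTop 1).and
        ((tendsto_natCast_atTop_atTop.comp (Nat.tendsto_div_const_atTop hN.ne')).eventually_ge_atTop
          ((h + δ / 2) / (δ / 2))))).mono ?_)
    rintro n ⟨h3, h4, h5⟩
    have hle : N * (n / N) ≤ n := Nat.mul_div_le n N
    have h1N : 1 ≤ N * (n / N) := Nat.mul_pos hN h4
    have hn0 : (0 : ℝ) < n := by exact_mod_cast (by omega : 0 < n)
    have h6 : φ n < (h + δ / 2) * n := by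
      rw [← div_lt_iff₀ hn0]
      exact (ENNReal.ofReal_lt_ofReal_iff (by linarith)).1 h3
    have h7 : φ (N * (n / N)) ≤ φ n := hmono h1N (h1N.trans hle) hle
    have h8 : (n : ℝ) ≤ N * ((n / N : ℕ) : ℝ) + N := by
      have h9 := Nat.div_add_mod n N
      have h10 := Nat.mod_lt n hN
      exact_mod_cast (by omega : n ≤ N * (n / N) + N)
    have h11 : h + δ / 2 ≤ δ / 2 * ((n / N : ℕ) : ℝ) := by
      rwa [Function.comp_apply, div_le_iff₀' (by linarith)] at h5
    calc φ (N * (n / N)) ≤ (h + δ / 2) * n := h7.trans h6.le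
      _ ≤ (h + δ / 2) * (N * ((n / N : ℕ) : ℝ) + N) := by gcongr
      _ = (h + δ / 2) * (N * ((n / N : ℕ) : ℝ)) + (h + δ / 2) * N := by ring
      _ ≤ (h + δ / 2) * (N * ((n / N : ℕ) : ℝ)) + δ / 2 * ((n / N : ℕ) : ℝ) * N := by gcongr
      _ = _ := by ring
  rw [hrate, one_div, ← ENNReal.ofReal_inv_of_pos hh0]
  refine le_of_forall_lt fun c hc => ?_
  have hct : c ≠ ⊤ := (hc.trans ENNReal.ofReal_lt_top).ne
  have hc1 : c.toReal < h⁻¹ := (ENNReal.lt_ofReal_iff_toReal_lt hct).1 hc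
  obtain ⟨r, hr1, hr2⟩ := exists_between hc1
  have hr0 : 0 < r := ENNReal.toReal_nonneg.trans_lt hr1
  calc c < ENNReal.ofReal r := (ENNReal.lt_ofReal_iff_toReal_lt hct).2 hr1
    _ ≤ _ := BetaExpansion.le_dimH_approxSet hβ hφ hh hev hfr hr0 (by rwa [one_div])
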